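/- Fix integers $L, D, P, N_0\ge 1$ (number of hidden layers, output dimension, training-set size, input dimension), weight precisions $\lambda_0,\dots,\lambda_L>0$ with $\lambda^*=\lambda_0\cdots\lambda_L$, an inverse temperature $\beta>0$, an arbitrary input matrix $X\in\mathbb R^{N_0\times P}$ and an arbitrary label vector $\mathbf y\in\mathbb R^{DP}$ (the $P$ labels in $\mathbb R^D$, stacked). Let $\mathcal S_D^+$ be the cone of real symmetric positive definite $D\times D$ matrices with its usual topology, and let $dQ=\prod_{i\le j}dQ_{ij}$ be Lebesgue measure on it. For $N>D$ let $$\mathcal W_D(Q|V,N)=\frac{\det(Q)^{\frac{N-D-1}{2}}e^{-\frac12\mathrm{tr}(V^{-1}Q)}}{\det(V)^{N/2}\,2^{DN/2}\,\pi^{D(D-1)/4}\prod_{k=1}^D\Gamma\big(\frac{N-D+k}{2}\big)}$$ be the Wishart density, and let all hidden layers have width $N$, so that the prior mixing measure on $(\mathcal S_D^+)^L$ is $$\mathcal Q_{L,N}(dQ_1\cdots dQ_L)=\prod_{\ell=1}^L\mathcal W_D\big(Q_\ell\,\big|\,\tfrac1N\mathbb 1_D,N\big)\,dQ_1\cdots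 dQ_L .$$ Write $Q_\ell=U_\ell^\top U_\ell$ for the Cholesky factorization ($U_\ell$ upper triangular with positive diagonal entries), and set $Q^{(L)}=(U_1\cdots U_L)^\top U_1\cdots U_L$, $\Sigma_{11}=\frac{X^\top X}{N_0\lambda^*}\otimes Q^{(L)}$, $$\Phi^\circ_\beta(Q_1,\dots,Q_L,\mathbf y)=\mathbf y^\top(\Sigma_{11}+\beta^{-1}\mathbb 1_{DP})^{-1}\mathbf y,\qquad R(Q_1,\dots,Q_L)=\log\det(\mathbb 1_{DP}+\beta\Sigma_{11}).$$ The posterior mixing measure of the fully connected deep linear network with Gaussian likelihood in the mean-field scaling $\mathcal L_N(\mathbf y|\mathbf s,\beta)=\mathcal L(\mathbf y|\mathbf s/\sqrt N,N\beta)$ is $$\mathcal Q^\circ_{L,N}(dQ_1\cdots dQ_L|\mathbf y,\beta)=\frac{e^{-\frac N2\Phi^\circ_\beta(Q_1,\dots,Q_L,\mathbf y)-\frac12R(Q_1,\dots,Q_L)}\,\mathcal Q_{L,N}(dQ_1\cdots dQ_L)}{\int_{(\mathcal S_D^+)^L}e^{-\frac N2\Phi^\circ_\beta-\frac12R}\,d\mathcal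 Q_{L,N}} .$$ Then, for every $N>D$, $\mathcal Q^\circ_{L,N}(\cdot|\mathbf y,\beta)$ is a well-defined probability measure on $(\mathcal S_D^+)^L$, the number $$\bar I_0=\frac12\inf_{(Q_1,\dots,Q_L)\in(\mathcal S_D^+)^L}\Big\{\sum_{\ell=1}^L\big(\mathrm{tr}(Q_\ell)-\log\det Q_\ell\big)+\Phi^\circ_\beta(Q_1,\dots,Q_L,\mathbf y)\Big\}$$ is finite, and as $N\to\infty$ (with everything else fixed) the measures $P_N=\mathcal Q^\circ_{L,N}(\cdot|\mathbf y,\beta)$ satisfy a large deviation principle on $(\mathcal S_D^+)^L$ at speed $N$ with rate function $$I^\circ(Q_1,\dots,Q_L)=\frac12\sum_{\ell=1}^L\big(\mathrm{tr}(Q_\ell)-\log\det Q_\ell\big)+\frac12\Phi^\circ_\beta(Q_1,\dots,Q_L,\mathbf y)-\bar I_0 .$$ That is, $I^\circ$ is nonnegative and lower semicontinuous, $\limsup_{N}\frac1N\log P_N(C)\le-\inf_C I^\circ$ for every closed $C\subset(\mathcal S_D^+)^L$, and $\liminf_N\frac1N\log P_N(O)\ge-\inf_O I^\circ$ for every open $O\subset(\mathcal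 S_D^+)^L$ (with $\log 0=-\infty$ and $\inf\emptyset=+\infty$). -/

import Mathlib

open MeasureTheory Filter Topology Matrix
open scoped ENNReal Kronecker

namespace DLN

/-- Large deviation principle at speed `N` with rate function `I`, for a sequence of (laws) `P N`
on a topological space: `I` is nonnegative and lower semicontinuous, and the upper bound on closed
sets and the lower bound on open sets hold (with `log 0 = -∞` and `inf ∅ = +∞`). -/
structure SatisfiesLDP {V : Type*} [TopologicalSpace V] [MeasurableSpace V]
    (P : ℕ → Measure V) (I : V → EReal) : Prop where
  nonneg : ∀ v, 0 ≤ I v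
  lowerSemicontinuous : LowerSemicontinuous I
  upper_bound : ∀ C : Set V, IsClosed C →
    limsup (fun N : ℕ => (((1 / (N : ℝ) : ℝ)) : EReal) * ENNReal.log (P N C)) atTop
      ≤ - ⨅ v ∈ C, I v
  lower_bound : ∀ O : Set V, IsOpen O →
    - (⨅ v ∈ O, I v)
      ≤ liminf (fun N : ℕ => (((1 / (N : ℝ) : ℝ)) : EReal) * ENNReal.log (P N O)) atTop

/-- The set `𝒮⁺_D` of symmetric positive definite real `D × D` matrices, with the topology
inherited from the space of matrices. -/
abbrev SPD (D : ℕ) : Type := {A : Matrix (Fin D) (Fin D) ℝ // A.PosDef}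

instance instMeasurableSpaceSPD (D : ℕ) : MeasurableSpace (SPD D) := borel (SPD D)

instance instBorelSpaceSPD (D : ℕ) : BorelSpace (SPD D) := ⟨rfl⟩

/-- The entries on and above the diagonal, which are the coordinates of a symmetric matrix. -/
def upperEntries (D : ℕ) (Q : SPD D) : {p : Fin D × Fin D // p.1 ≤ p.2} → ℝ :=
  fun p => Q.1 p.1.1 p.1.2

/-- The Lebesgue measure `dQ = ∏_{i ≤ j} dQ_{ij}` on the cone of symmetric positive definite
matrices. -/
noncomputable def lebesgueSPD (D : ℕ) : Measure (SPD D) :=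
  Measure.comap (upperEntries D) volume

/-- The symmetric matrix with prescribed entries on and above the diagonal. -/
def symmOfUpper (D : ℕ) (v : {p : Fin D × Fin D // p.1 ≤ p.2} → ℝ) :
    Matrix (Fin D) (Fin D) ℝ :=
  Matrix.of fun i j => if h : i ≤ j then v ⟨(i, j), h⟩ else v ⟨(j, i), (not_le.mp h).le⟩

theorem continuous_symmOfUpper (D : ℕ) : Continuous (symmOfUpper D) := by
  refine continuous_matrix fun i j => ?_
  by_cases h : i ≤ j
  · simpa [symmOfUpper, h] using continuous_apply _
  · simpa [symmOfUpper, h] using continuous_apply _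

theorem symmOfUpper_upperEntries (D : ℕ) (Q : SPD D) :
    symmOfUpper D (upperEntries D Q) = Q.1 := by
  ext i j
  by_cases h : i ≤ j
  · simp [symmOfUpper, upperEntries, h]
  · simpa [symmOfUpper, upperEntries, h] using Q.2.isHermitian.apply i j

theorem upperEntries_symmOfUpper (D : ℕ) (v : {p : Fin D × Fin D // p.1 ≤ p.2} → ℝ)
    (h : (symmOfUpper D v).PosDef) : upperEntries D ⟨symmOfUpper D v, h⟩ = v := by
  ext ⟨⟨i, j⟩, hij⟩
  have hij' : i ≤ j := hij
  simp [symmOfUpper, upperEntries, hij']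

theorem measurableSet_posDef (D : ℕ) :
    MeasurableSet {v | (symmOfUpper D v).PosDef} := by
  have hsymm : ∀ v, (symmOfUpper D v).IsHermitian := by
    intro v
    ext i j
    rcases lt_trichotomy i j with h | h | h
    · simp [symmOfUpper, h.le, not_le.mpr h]
    · subst h; simp [symmOfUpper]
    · simp [symmOfUpper, h.le, not_le.mpr h]
  have hset : {v | (symmOfUpper D v).PosDef} =
      (⋂ x : Fin D → ℝ, {v | 0 ≤ x ⬝ᵥ (symmOfUpper D v *ᵥ x)}) ∩
        {v | (symmOfUpper D v).det ≠ 0} := by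
    ext v
    simp only [Set.mem_ofPred_eq, Set.mem_inter_iff, Set.mem_iInter]
    constructor
    · intro h
      exact ⟨fun x => by simpa using h.posSemidef.dotProduct_mulVec_nonneg x, h.det_pos.ne'⟩
    · rintro ⟨h1, h2⟩
      have hp : (symmOfUpper D v).PosSemidef :=
        Matrix.PosSemidef.of_dotProduct_mulVec_nonneg (hsymm v) (by simpa using h1)
      exact hp.posDef_iff_isUnit.mpr ((Matrix.isUnit_iff_isUnit_det _).mpr h2.isUnit)
  rw [hset]
  have hc := continuous_symmOfUpper D
  refine MeasurableSet.inter (IsClosed.measurableSet ?_) (IsOpen.measurableSet ?_)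
  · exact isClosed_iInter fun x => isClosed_le continuous_const
      (continuous_const.dotProduct (hc.matrix_mulVec continuous_const))
  · exact isOpen_ne_fun hc.matrix_det continuous_const

/-- The coordinate map is a measurable embedding, so `lebesgueSPD D A` is the Lebesgue measure of
the image of `A` in coordinates. -/
theorem measurableEmbedding_upperEntries (D : ℕ) : MeasurableEmbedding (upperEntries D) := by
  have hcont : Continuous (upperEntries D) := by
    refine continuous_pi fun p => ?_
    exact (continuous_apply_apply p.1.1 p.1.2).comp
      (continuous_subtype_val : Continuous fun Q : SPD D => Q.1)
  have hinj : Function.Injective (upperEntries D) := by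
    intro Q R h
    apply Subtype.ext
    rw [← symmOfUpper_upperEntries, ← symmOfUpper_upperEntries, h]
  have hemb : IsEmbedding (upperEntries D) := by
    refine IsEmbedding.of_comp hcont (continuous_symmOfUpper D) ?_
    have : symmOfUpper D ∘ upperEntries D = Subtype.val :=
      funext (symmOfUpper_upperEntries D)
    rw [this]
    exact IsEmbedding.subtypeVal
  refine hemb.measurableEmbedding ?_
  have : Set.range (upperEntries D) = {v | (symmOfUpper D v).PosDef} := by
    ext v
    constructor
    · rintro ⟨Q, rfl⟩
      simpa [symmOfUpper_upperEntries] using Q.2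
    · intro h
      exact ⟨⟨_, h⟩, upperEntries_symmOfUpper D v h⟩
  rw [this]
  exact measurableSet_posDef D

/-- The Wishart density `𝒲_D(Q | V, N)` with `N > D` degrees of freedom and scale matrix `V`,
with respect to `dQ`. The normalization contains `∏_{k=1}^D Γ((N - D + k) / 2)`; an element
`k : Fin D` stands for the index `k + 1` of that product. -/
noncomputable def wishartDensity (D : ℕ) (V : Matrix (Fin D) (Fin D) ℝ) (N : ℕ)
    (Q : Matrix (Fin D) (Fin D) ℝ) : ℝ :=
  (Q.det ^ (((N : ℝ) - D - 1) / 2) * Real.exp (-(1 / 2) * (V⁻¹ * Q).trace)) /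
    (V.det ^ ((N : ℝ) / 2) * 2 ^ ((D : ℝ) * N / 2) * Real.pi ^ ((D : ℝ) * ((D : ℝ) - 1) / 4) *
      ∏ k : Fin D, Real.Gamma (((N : ℝ) - D + ((k : ℕ) + 1)) / 2))

/-- The prior mixing measure `𝒬_{L,N}` on `(𝒮⁺_D)^L`, for layers of widths `n ℓ`: the measure with
density `∏_ℓ 𝒲_D(Q_ℓ | n_ℓ⁻¹ 𝟙, n_ℓ)` with respect to `dQ_1 ⋯ dQ_L`. -/
noncomputable def priorMixing (L D : ℕ) (n : Fin L → ℕ) : Measure (Fin L → SPD D) :=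
  (Measure.pi fun _ : Fin L => lebesgueSPD D).withDensity fun Q =>
    ENNReal.ofReal
      (∏ ℓ, wishartDensity D ((n ℓ : ℝ)⁻¹ • (1 : Matrix (Fin D) (Fin D) ℝ)) (n ℓ) (Q ℓ).1)

/-- Existence of the Cholesky factorization `Q = Uᵀ U`, with `U` upper triangular (so `Uᵀ` lower
triangular) with positive diagonal entries. -/
theorem exists_cholesky {D : ℕ} (Q : SPD D) :
    ∃ U : Matrix (Fin D) (Fin D) ℝ,
      (∀ i j, j < i → U i j = 0) ∧ (∀ i, 0 < U i i) ∧ Uᵀ * U = Q.1 := by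
  obtain ⟨S, hS⟩ := Q
  have hinv : IsUnit (LDL.lowerInv hS) := isUnit_of_invertible _
  have hd : ∀ i, 0 < LDL.diagEntries hS i := by
    have h : (LDL.diag hS).PosDef := by
      rw [LDL.diag_eq_lowerInv_conj]
      exact (hinv.posDef_star_right_conjugate_iff).mpr hS
    exact Matrix.posDef_diagonal_iff.mp h
  have htri : ∀ i j, i < j → LDL.lower hS i j = 0 := by
    have h1 : (LDL.lowerInv hS).BlockTriangular OrderDual.toDual :=
      fun i j hij => LDL.lowerInv_triangular hS hij
    have h2 := Matrix.blockTriangular_inv_of_blockTriangular h1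
    exact fun i j hij => h2 hij
  have hlow : ∀ i, LDL.lower hS i i ≠ 0 := by
    have hdet : (LDL.lower hS).det ≠ 0 := by
      rw [LDL.lower, Matrix.det_nonsing_inv]
      have := (Matrix.isUnit_iff_isUnit_det _).mp hinv
      simpa using this.ne_zero
    rw [Matrix.det_of_isLowerTriangular _ (fun i j hij => htri i j hij)] at hdet
    exact fun i => (Finset.prod_ne_zero_iff.mp hdet) i (Finset.mem_univ i)
  refine ⟨Matrix.of fun i j => |LDL.lower hS i i| / LDL.lower hS i i *
    √(LDL.diagEntries hS i) * LDL.lower hS j i, ?_, ?_, ?_⟩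
  · intro i j hij
    simp [htri j i hij]
  · intro i
    have h1 := Real.sqrt_pos.mpr (hd i)
    have h2 := abs_pos.mpr (hlow i)
    have : |LDL.lower hS i i| / LDL.lower hS i i * √(LDL.diagEntries hS i) * LDL.lower hS i i
        = |LDL.lower hS i i| * √(LDL.diagEntries hS i) := by
      field_simp [hlow i]
    simp only [Matrix.of_apply, this]
    positivity
  · refine Eq.trans ?_ (LDL.lower_conj_diag hS)
    ext i j
    rw [LDL.diag, Matrix.mul_apply, Matrix.mul_apply]
    simp only [Matrix.mul_diagonal, Matrix.transpose_apply, Matrix.of_apply,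
      Matrix.conjTranspose_apply, star_trivial]
    refine Finset.sum_congr rfl fun k _ => ?_
    have h1 := Real.mul_self_sqrt (hd k).le
    have h2 : |LDL.lower hS k k| / LDL.lower hS k k * (|LDL.lower hS k k| / LDL.lower hS k k)
        = 1 := by
      rw [div_mul_div_comm, abs_mul_abs_self, div_self (mul_ne_zero (hlow k) (hlow k))]
    linear_combination (LDL.lower hS i k * LDL.lower hS j k) *
      (√(LDL.diagEntries hS k) * √(LDL.diagEntries hS k) * h2 + h1)

/-- The Cholesky factor `U` of `Q = Uᵀ U`. -/
noncomputable def cholesky {D : ℕ} (Q : SPD D) : Matrix (Fin D) (Fin D) ℝ :=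
  Classical.choose (exists_cholesky Q)

theorem cholesky_spec {D : ℕ} (Q : SPD D) :
    (∀ i j, j < i → cholesky Q i j = 0) ∧ (∀ i, 0 < cholesky Q i i) ∧
      (cholesky Q)ᵀ * cholesky Q = Q.1 :=
  Classical.choose_spec (exists_cholesky Q)

/-- `Q^{(L)} = (U_1 ⋯ U_L)ᵀ (U_1 ⋯ U_L)`. -/
noncomputable def outputCov {L D : ℕ} (Q : Fin L → SPD D) : Matrix (Fin D) (Fin D) ℝ :=
  (List.ofFn fun ℓ => cholesky (Q ℓ)).prodᵀ * (List.ofFn fun ℓ => cholesky (Q ℓ)).prod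

/-- `Σ₁₁ = (N₀ λ*)⁻¹ XᵀX ⊗ Q^{(L)}` with `λ* = λ_0 ⋯ λ_L`; rows and columns are indexed by
(training example, output coordinate). -/
noncomputable def sigma11 {L D P N₀ : ℕ} (lam : Fin (L + 1) → ℝ)
    (X : Matrix (Fin N₀) (Fin P) ℝ) (Q : Fin L → SPD D) :
    Matrix (Fin P × Fin D) (Fin P × Fin D) ℝ :=
  (((N₀ : ℝ) * ∏ ℓ, lam ℓ)⁻¹ • (Xᵀ * X)) ⊗ₖ outputCov Q

/-- `Φ°_β = yᵀ (Σ₁₁ + β⁻¹ 𝟙)⁻¹ y`. -/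
noncomputable def phiMF {L D P N₀ : ℕ} (lam : Fin (L + 1) → ℝ)
    (X : Matrix (Fin N₀) (Fin P) ℝ) (y : Fin P × Fin D → ℝ) (β : ℝ) (Q : Fin L → SPD D) : ℝ :=
  y ⬝ᵥ ((sigma11 lam X Q + β⁻¹ • (1 : Matrix (Fin P × Fin D) (Fin P × Fin D) ℝ))⁻¹ *ᵥ y)

/-- `R = log det (𝟙 + β Σ₁₁)`. -/
noncomputable def logDetTerm {L D P N₀ : ℕ} (lam : Fin (L + 1) → ℝ)
    (X : Matrix (Fin N₀) (Fin P) ℝ) (β : ℝ) (Q : Fin L → SPD D) : ℝ :=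
  Real.log (1 + β • sigma11 lam X Q).det

/-- The weight `exp(-(N/2) Φ°_β - R/2)`. -/
noncomputable def weightMF {L D P N₀ : ℕ} (lam : Fin (L + 1) → ℝ)
    (X : Matrix (Fin N₀) (Fin P) ℝ) (y : Fin P × Fin D → ℝ) (β : ℝ) (N : ℕ)
    (Q : Fin L → SPD D) : ℝ≥0∞ :=
  ENNReal.ofReal
    (Real.exp (-((N : ℝ) / 2) * phiMF lam X y β Q - (1 / 2) * logDetTerm lam X β Q))

/-- The rescaled posterior mixing measure `𝒬°_{L,N}(· | y, β)`, all hidden widths being `N`. -/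
noncomputable def posteriorMF {L D P N₀ : ℕ} (lam : Fin (L + 1) → ℝ)
    (X : Matrix (Fin N₀) (Fin P) ℝ) (y : Fin P × Fin D → ℝ) (β : ℝ) (N : ℕ) :
    Measure (Fin L → SPD D) :=
  (∫⁻ Q, weightMF lam X y β N Q ∂(priorMixing L D fun _ => N))⁻¹ •
    (priorMixing L D fun _ => N).withDensity (weightMF lam X y β N)

/-- `∑_ℓ (tr Q_ℓ - log det Q_ℓ) + Φ°_β(Q_1, …, Q_L, y)`. -/
noncomputable def actionMF {L D P N₀ : ℕ} (lam : Fin (L + 1) → ℝ)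
    (X : Matrix (Fin N₀) (Fin P) ℝ) (y : Fin P × Fin D → ℝ) (β : ℝ) (Q : Fin L → SPD D) : ℝ :=
  ∑ ℓ, ((Q ℓ).1.trace - Real.log (Q ℓ).1.det) + phiMF lam X y β Q

/-- The rate function `I° = ½ ∑_ℓ (tr Q_ℓ - log det Q_ℓ) + ½ Φ°_β - Ī₀`, where
`Ī₀ = ½ inf (∑_ℓ (tr Q_ℓ - log det Q_ℓ) + Φ°_β)`. -/
noncomputable def rateMF {L D P N₀ : ℕ} (lam : Fin (L + 1) → ℝ)
    (X : Matrix (Fin N₀) (Fin P) ℝ) (y : Fin P × Fin D → ℝ) (β : ℝ) (Q : Fin L → SPD D) : ℝ :=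
  (1 / 2) * ∑ ℓ, ((Q ℓ).1.trace - Real.log (Q ℓ).1.det) + (1 / 2) * phiMF lam X y β Q
    - (1 / 2) * ⨅ Q' : Fin L → SPD D, actionMF lam X y β Q'

end DLN

/-!
For `N > D` the posterior density with respect to `∏_ℓ dQ_ℓ` equals, up to a constant which cancels
in the normalization,
`∏_ℓ det(Q_ℓ)^(-(D+1)/2) · exp(-R/2) · exp(-N · actionMF / 2)`,
because `det(Q)^((N-D-1)/2) exp(-(N/2) tr Q) = det(Q)^(-(D+1)/2) exp(-(N/2)(tr Q - log det Q))`. So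
the posterior is the Gibbs measure at inverse temperature `N`, with energy `actionMF / 2`, over a
reference measure which does not depend on `N` (`posteriorMF_eq_gibbs`), and the large deviation
principle is a Laplace principle (`satisfiesLDP_gibbs`). Its upper bound comes from
`exp(-N B) ≤ exp(-(N - n₀) a) exp(-n₀ B)` where `B ≥ a`, so it holds for all measurable sets at once,
without exponential tightness. Its lower bound uses a small neighbourhood of a point.

Three facts about the model are needed.
* The energy is continuous. The only point here is the continuity of the Cholesky factor, which
  follows from the Gram–Schmidt recursion for its rows (`continuous_cholesky`).
* The reference measure charges nonempty open sets. This holds since the positive definite cone is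
  open in the coordinates on and above the diagonal (`isOpenEmbedding_upperEntries`).
* The partition function is finite. The energy is nonnegative, so it suffices to take `N = D + 1`,
  where the powers of the determinants cancel and the integrand is at most
  `∏_ℓ exp(-(D+1)/2 · tr Q_ℓ)`. This is integrable because the trace dominates the absolute values
  of the entries (`integrable_exp_neg_trace`).
-/

/-! ### Exponential rates of sequences in `[0, ∞]` -/

namespace DLN

theorem tendsto_one_div_mul_log_const_mul_exp {K : ℝ} (hK : 0 < K) (a : ℝ) :
    Tendsto (fun N : ℕ => (((1 / (N : ℝ) : ℝ)) : EReal) *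
      ENNReal.log (ENNReal.ofReal (K * Real.exp (-(N * a))))) atTop (𝓝 ((-a : ℝ) : EReal)) := by
  have h : Tendsto (fun N : ℕ => 1 / (N : ℝ) * Real.log K - a) atTop (𝓝 (-a)) := by
    simpa using (tendsto_one_div_atTop_nhds_zero_nat.mul_const (Real.log K)).sub_const a
  refine (continuous_coe_real_ereal.tendsto _ |>.comp h).congr' ?_
  filter_upwards [eventually_ge_atTop 1] with N hN
  have hN' : (N : ℝ) ≠ 0 := by positivity
  rw [ENNReal.log_ofReal_of_pos (by positivity), ← EReal.coe_mul,
    Real.log_mul hK.ne' (Real.exp_ne_zero _), Real.log_exp, Function.comp_apply]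
  congr 1
  field_simp
  ring

theorem limsup_one_div_mul_log_le {p : ℕ → ℝ≥0∞} {K a : ℝ} (hK : 0 < K)
    (h : ∀ᶠ N : ℕ in atTop, p N ≤ ENNReal.ofReal (K * Real.exp (-(N * a)))) :
    limsup (fun N : ℕ => (((1 / (N : ℝ) : ℝ)) : EReal) * ENNReal.log (p N)) atTop
      ≤ ((-a : ℝ) : EReal) := by
  rw [← (tendsto_one_div_mul_log_const_mul_exp hK a).limsup_eq]
  refine limsup_le_limsup ?_
  filter_upwards [h] with N hN
  exact mul_le_mul_of_nonneg_left (ENNReal.log_monotone hN)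
    (EReal.coe_nonneg.mpr (by positivity))

theorem le_liminf_one_div_mul_log {p : ℕ → ℝ≥0∞} {K a : ℝ} (hK : 0 < K)
    (h : ∀ᶠ N : ℕ in atTop, ENNReal.ofReal (K * Real.exp (-(N * a))) ≤ p N) :
    ((-a : ℝ) : EReal) ≤
      liminf (fun N : ℕ => (((1 / (N : ℝ) : ℝ)) : EReal) * ENNReal.log (p N)) atTop := by
  rw [← (tendsto_one_div_mul_log_const_mul_exp hK a).liminf_eq]
  refine liminf_le_liminf ?_
  filter_upwards [h] with N hN
  exact mul_le_mul_of_nonneg_left (ENNReal.log_monotone hN)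
    (EReal.coe_nonneg.mpr (by positivity))

/-! ### Large deviations of Gibbs measures -/

/-- The unnormalized Gibbs weight `exp(-N B)` of an energy `B` at inverse temperature `N`. -/
noncomputable def gibbsWeight {V : Type*} (B : V → ℝ) (N : ℕ) (v : V) : ℝ≥0∞ :=
  ENNReal.ofReal (Real.exp (-(N * B v)))

section Gibbs

variable {V : Type*} [MeasurableSpace V] {ν : Measure V} {B : V → ℝ}

/-- On a set where the energy is at least `a`, raising the inverse temperature from `n₀` to `N`
gains a factor `exp(-(N - n₀) a)`. No compactness is involved. -/
theorem setLIntegral_gibbsWeight_le {S : Set V} (hS : MeasurableSet S)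
    {a : ℝ} (ha : ∀ v ∈ S, a ≤ B v) {n₀ N : ℕ} (hN : n₀ ≤ N) :
    ∫⁻ v in S, gibbsWeight B N v ∂ν ≤
      ENNReal.ofReal (Real.exp (-((N - n₀) * a))) * ∫⁻ v, gibbsWeight B n₀ v ∂ν := by
  have hN' : (0 : ℝ) ≤ N - n₀ := by
    rw [sub_nonneg]
    exact_mod_cast hN
  calc ∫⁻ v in S, gibbsWeight B N v ∂ν
      ≤ ∫⁻ v in S, ENNReal.ofReal (Real.exp (-((N - n₀) * a))) * gibbsWeight B n₀ v ∂ν := by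
        refine setLIntegral_mono' hS fun v hv => ?_
        rw [gibbsWeight, gibbsWeight, ← ENNReal.ofReal_mul (Real.exp_pos _).le, ← Real.exp_add]
        refine ENNReal.ofReal_le_ofReal (Real.exp_le_exp.mpr ?_)
        nlinarith [mul_le_mul_of_nonneg_left (ha v hv) hN']
    _ = ENNReal.ofReal (Real.exp (-((N - n₀) * a))) * ∫⁻ v in S, gibbsWeight B n₀ v ∂ν :=
        lintegral_const_mul' _ _ ENNReal.ofReal_ne_top
    _ ≤ _ := by
        gcongr
        exact Measure.restrict_le_self

variable [TopologicalSpace V] [OpensMeasurableSpace V]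

/-- The energy stays below `a` on a neighbourhood of `v`, and that neighbourhood carries mass. -/
theorem exists_le_setLIntegral_gibbsWeight [ν.IsOpenPosMeasure] (hB : Continuous B) {O : Set V}
    (hO : IsOpen O) {v : V} (hv : v ∈ O) {a : ℝ} (ha : B v < a) :
    ∃ k : ℝ, 0 < k ∧ ∀ N : ℕ,
      ENNReal.ofReal (k * Real.exp (-(N * a))) ≤ ∫⁻ v in O, gibbsWeight B N v ∂ν := by
  have hU : IsOpen (O ∩ {w | B w < a}) := hO.inter (isOpen_lt hB continuous_const)
  have hpos : 0 < ν (O ∩ {w | B w < a}) := hU.measure_pos ν ⟨v, hv, ha⟩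
  -- The neighbourhood may have infinite mass, hence the truncation at `1`.
  have hne : min (ν (O ∩ {w | B w < a})) 1 ≠ ∞ := ne_top_of_le_ne_top ENNReal.one_ne_top
    (min_le_right _ _)
  refine ⟨(min (ν (O ∩ {w | B w < a})) 1).toReal,
    ENNReal.toReal_pos (lt_min hpos one_pos).ne' hne, fun N => ?_⟩
  rw [ENNReal.ofReal_mul ENNReal.toReal_nonneg, ENNReal.ofReal_toReal hne]
  calc min (ν (O ∩ {w | B w < a})) 1 * ENNReal.ofReal (Real.exp (-(N * a)))
      ≤ ENNReal.ofReal (Real.exp (-(N * a))) * ν (O ∩ {w | B w < a}) := by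
        rw [mul_comm]
        gcongr
        exact min_le_left _ _
    _ = ∫⁻ _ in O ∩ {w | B w < a}, ENNReal.ofReal (Real.exp (-(N * a))) ∂ν := by simp
    _ ≤ ∫⁻ v in O ∩ {w | B w < a}, gibbsWeight B N v ∂ν := by
        refine setLIntegral_mono' hU.measurableSet fun w hw => ?_
        refine ENNReal.ofReal_le_ofReal (Real.exp_le_exp.mpr ?_)
        have : B w ≤ a := le_of_lt hw.2
        gcongr
    _ ≤ _ := lintegral_mono_set Set.inter_subset_left

/-- **Laplace principle.** The Gibbs measures `Z_N⁻¹ exp(-N B) ν` of a continuous energy that is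
bounded below satisfy a large deviation principle with rate function `B - inf B`, provided that the
partition function is finite at one inverse temperature. -/
theorem satisfiesLDP_gibbs [Nonempty V] [ν.IsOpenPosMeasure] (hB : Continuous B)
    (hb : BddBelow (Set.range B)) {n₀ : ℕ} (hfin : ∫⁻ v, gibbsWeight B n₀ v ∂ν ≠ ∞)
    {P : ℕ → Measure V} (hP : ∀ N, n₀ ≤ N →
      P N = (∫⁻ v, gibbsWeight B N v ∂ν)⁻¹ • ν.withDensity (gibbsWeight B N)) :
    SatisfiesLDP P fun v => ((B v - ⨅ w, B w : ℝ) : EReal) := by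
  set b := ⨅ w, B w with hbdef
  have hle : ∀ v, b ≤ B v := fun v => ciInf_le hb v
  have hZlow : ∀ a, b < a → ∃ k : ℝ, 0 < k ∧ ∀ N : ℕ,
      ENNReal.ofReal (k * Real.exp (-(N * a))) ≤ ∫⁻ v, gibbsWeight B N v ∂ν := by
    intro a ha
    obtain ⟨v, hv⟩ := exists_lt_of_ciInf_lt ha
    simpa using exists_le_setLIntegral_gibbsWeight (ν := ν) hB isOpen_univ (Set.mem_univ v) hv
  obtain ⟨z, hz, hzeq⟩ : ∃ z : ℝ, 0 < z ∧ ∫⁻ v, gibbsWeight B n₀ v ∂ν = ENNReal.ofReal z := by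
    obtain ⟨k, hk, hkN⟩ := hZlow (b + 1) (lt_add_one b)
    refine ⟨_, ENNReal.toReal_pos ?_ hfin, (ENNReal.ofReal_toReal hfin).symm⟩
    exact ((ENNReal.ofReal_pos.mpr (by positivity)).trans_le (hkN n₀)).ne'
  have hPS : ∀ S, MeasurableSet S → ∀ N, n₀ ≤ N →
      P N S = (∫⁻ v, gibbsWeight B N v ∂ν)⁻¹ * ∫⁻ v in S, gibbsWeight B N v ∂ν := by
    intro S hS N hN
    rw [hP N hN, Measure.smul_apply, withDensity_apply _ hS, smul_eq_mul]
  refine ⟨fun v => ?_, ?_, fun C hC => ?_, fun O hO => ?_⟩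
  · exact EReal.coe_nonneg.mpr (sub_nonneg.mpr (hle v))
  · exact (continuous_coe_real_ereal.comp (hB.sub continuous_const)).lowerSemicontinuous
  · refine EReal.le_of_forall_lt_iff_le.mp fun t ht => ?_
    obtain ⟨s, hs, hst⟩ := EReal.lt_iff_exists_real_btwn.mp ht
    have hst' : s < t := EReal.coe_lt_coe_iff.mp hst
    have hBC : ∀ v ∈ C, b - s ≤ B v := by
      intro v hv
      have h1 : ((-s : ℝ) : EReal) < ((B v - b : ℝ) : EReal) := by
        rw [EReal.coe_neg]
        exact (EReal.neg_lt_comm.mp hs).trans_le (iInf₂_le v hv)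
      have := EReal.coe_lt_coe_iff.mp h1
      linarith
    obtain ⟨k, hk, hkN⟩ := hZlow (b + (t - s)) (by linarith)
    have key := limsup_one_div_mul_log_le (p := fun N => P N C) (a := -t)
      (K := k⁻¹ * z * Real.exp (n₀ * (b - s))) (by positivity) ?_
    · simpa using key
    filter_upwards [eventually_ge_atTop n₀] with N hN
    rw [hPS C hC.measurableSet N hN]
    calc _ ≤ (ENNReal.ofReal (k * Real.exp (-(N * (b + (t - s))))))⁻¹ *
          (ENNReal.ofReal (Real.exp (-((N - n₀) * (b - s)))) * ENNReal.ofReal z) := by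
          rw [← hzeq]
          gcongr
          · exact hkN N
          · exact setLIntegral_gibbsWeight_le hC.measurableSet hBC hN
      _ = _ := by
          rw [← ENNReal.ofReal_inv_of_pos (by positivity),
            ← ENNReal.ofReal_mul (by positivity), ← ENNReal.ofReal_mul (by positivity)]
          congr 1
          rw [mul_inv, ← Real.exp_neg]
          have : Real.exp (n₀ * (b - s)) * Real.exp (-(N * -t)) =
              Real.exp (- -(N * (b + (t - s)))) * Real.exp (-((N - n₀) * (b - s))) := by
            rw [← Real.exp_add, ← Real.exp_add]
            congr 1
            ring
          linear_combination (-(k⁻¹ * z)) * this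
  · refine EReal.ge_of_forall_gt_iff_ge.mp fun t ht => ?_
    obtain ⟨v, hv, hvt⟩ : ∃ v ∈ O, ((B v - b : ℝ) : EReal) < ((-t : ℝ) : EReal) := by
      have := EReal.lt_neg_comm.mp ht
      rw [← EReal.coe_neg] at this
      simpa only [iInf_lt_iff, exists_prop] using this
    have hvt' := EReal.coe_lt_coe_iff.mp hvt
    obtain ⟨k, hk, hkN⟩ :=
      exists_le_setLIntegral_gibbsWeight (ν := ν) hB hO hv (a := b - t) (by linarith)
    have key := le_liminf_one_div_mul_log (p := fun N => P N O) (a := -t)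
      (K := k * z⁻¹ * Real.exp (-(n₀ * b))) (by positivity) ?_
    · simpa using key
    filter_upwards [eventually_ge_atTop n₀] with N hN
    rw [hPS O hO.measurableSet N hN]
    calc _ = (ENNReal.ofReal (Real.exp (-((N - n₀) * b))) * ENNReal.ofReal z)⁻¹ *
          ENNReal.ofReal (k * Real.exp (-(N * (b - t)))) := by
          rw [← ENNReal.ofReal_mul (by positivity), ← ENNReal.ofReal_inv_of_pos (by positivity),
            ← ENNReal.ofReal_mul (by positivity)]
          congr 1
          rw [mul_inv, ← Real.exp_neg]
          have : Real.exp (-(n₀ * b)) * Real.exp (-(N * -t)) =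
              Real.exp (- -((N - n₀) * b)) * Real.exp (-(N * (b - t))) := by
            rw [← Real.exp_add, ← Real.exp_add]
            congr 1
            ring
          linear_combination (k * z⁻¹) * this
      _ ≤ _ := by
          rw [← hzeq]
          gcongr
          · have := setLIntegral_gibbsWeight_le (ν := ν) MeasurableSet.univ (fun v _ => hle v) hN
            rwa [setLIntegral_univ] at this
          · exact hkN N

/-- The normalization is legitimate: the partition function is positive and finite. -/
theorem isProbabilityMeasure_gibbs [Nonempty V] [ν.IsOpenPosMeasure] (hB : Continuous B)
    {N : ℕ} (hfin : ∫⁻ v, gibbsWeight B N v ∂ν ≠ ∞) :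
    IsProbabilityMeasure
      ((∫⁻ v, gibbsWeight B N v ∂ν)⁻¹ • ν.withDensity (gibbsWeight B N)) := by
  refine ⟨?_⟩
  obtain ⟨v⟩ := ‹Nonempty V›
  obtain ⟨k, hk, hkN⟩ := exists_le_setLIntegral_gibbsWeight (ν := ν) hB isOpen_univ
    (Set.mem_univ v) (lt_add_one (B v))
  have hpos : ∫⁻ v, gibbsWeight B N v ∂ν ≠ 0 := by
    have := (ENNReal.ofReal_pos.mpr (by positivity)).trans_le (hkN N)
    rw [setLIntegral_univ] at this
    exact this.ne'
  rw [Measure.smul_apply, withDensity_apply _ MeasurableSet.univ, setLIntegral_univ, smul_eq_mul,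
    ENNReal.inv_mul_cancel hpos hfin]

end Gibbs

end DLN

/-! ### The cone of positive definite matrices -/

namespace DLN

instance instNonemptySPD (D : ℕ) : Nonempty (SPD D) := ⟨⟨1, Matrix.PosDef.one⟩⟩

theorem SPD.continuous_entry {D : ℕ} (i j : Fin D) : Continuous fun Q : SPD D => Q.1 i j :=
  (continuous_subtype_val : Continuous fun Q : SPD D => Q.1).matrix_elem i j

theorem isHermitian_symmOfUpper (D : ℕ) (v : {p : Fin D × Fin D // p.1 ≤ p.2} → ℝ) :
    (symmOfUpper D v).IsHermitian := by
  ext i j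
  rcases lt_trichotomy i j with h | h | h
  · simp [symmOfUpper, h.le, not_le.mpr h]
  · subst h
    simp [symmOfUpper]
  · simp [symmOfUpper, h.le, not_le.mpr h]

/-- Positive definiteness is positivity of the quadratic form on the unit sphere, which is compact,
so it persists under small perturbations. -/
theorem isOpen_posDef_symmOfUpper (D : ℕ) : IsOpen {v | (symmOfUpper D v).PosDef} := by
  have hiff : ∀ v, (symmOfUpper D v).PosDef ↔
      ∀ x ∈ Metric.sphere (0 : Fin D → ℝ) 1, 0 < x ⬝ᵥ (symmOfUpper D v *ᵥ x) := by
    intro v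
    constructor
    · intro h x hx
      have hx0 : x ≠ 0 := by
        rintro rfl
        simp at hx
      simpa using h.dotProduct_mulVec_pos hx0
    · intro h
      refine Matrix.PosDef.of_dotProduct_mulVec_pos (isHermitian_symmOfUpper D v) fun x hx => ?_
      have hn : 0 < ‖x‖ := norm_pos_iff.mpr hx
      have h1 := h (‖x‖⁻¹ • x) (by simp [norm_smul, hn.ne'])
      rw [mulVec_smul, smul_dotProduct, dotProduct_smul, smul_smul, smul_eq_mul] at h1
      simpa using pos_of_mul_pos_right h1 (by positivity)
  rw [isOpen_iff_mem_nhds]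
  intro v hv
  have h := (isCompact_sphere (0 : Fin D → ℝ) 1).eventually_forall_of_forall_eventually
    (x₀ := v) (P := fun v x => 0 < x ⬝ᵥ (symmOfUpper D v *ᵥ x)) ?_
  · filter_upwards [h] with w hw
    exact (hiff w).mpr hw
  · intro x hx
    have hc : Continuous fun z : ({p : Fin D × Fin D // p.1 ≤ p.2} → ℝ) × (Fin D → ℝ) =>
        z.2 ⬝ᵥ (symmOfUpper D z.1 *ᵥ z.2) :=
      continuous_snd.dotProduct
        (((continuous_symmOfUpper D).comp continuous_fst).matrix_mulVec continuous_snd)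
    exact (isOpen_lt continuous_const hc).mem_nhds ((hiff v).mp hv x hx)

theorem isOpenEmbedding_upperEntries (D : ℕ) : IsOpenEmbedding (upperEntries D) := by
  have hcont : Continuous (upperEntries D) :=
    continuous_pi fun p => SPD.continuous_entry p.1.1 p.1.2
  refine ⟨IsEmbedding.of_comp hcont (continuous_symmOfUpper D) ?_, ?_⟩
  · rw [show symmOfUpper D ∘ upperEntries D = Subtype.val from
      funext (symmOfUpper_upperEntries D)]
    exact IsEmbedding.subtypeVal
  · convert isOpen_posDef_symmOfUpper D
    ext v
    constructor
    · rintro ⟨Q, rfl⟩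
      simpa [symmOfUpper_upperEntries] using Q.2
    · intro h
      exact ⟨⟨_, h⟩, upperEntries_symmOfUpper D v h⟩

instance instSecondCountableTopologySPD (D : ℕ) : SecondCountableTopology (SPD D) :=
  (isOpenEmbedding_upperEntries D).isEmbedding.secondCountableTopology

instance instIsOpenPosMeasureLebesgueSPD (D : ℕ) : (lebesgueSPD D).IsOpenPosMeasure :=
  Measure.IsOpenPosMeasure.comap _ (isOpenEmbedding_upperEntries D)

instance instSigmaFiniteLebesgueSPD (D : ℕ) : SigmaFinite (lebesgueSPD D) := by
  refine SigmaFinite.of_map _ (measurableEmbedding_upperEntries D).measurable.aemeasurable ?_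
  rw [lebesgueSPD, (measurableEmbedding_upperEntries D).map_comap]
  infer_instance

/-! ### Cholesky factors -/

theorem SPD.entry_eq_sum_cholesky {D : ℕ} (Q : SPD D) (i j : Fin D) :
    Q.1 i j = ∑ k, cholesky Q k i * cholesky Q k j := by
  conv_lhs => rw [← (cholesky_spec Q).2.2]
  simp [Matrix.mul_apply]

/-- Row `i` of the Cholesky factor is obtained from the rows above it by the Gram–Schmidt formulas,
which are continuous because the diagonal entries are positive. -/
theorem continuous_cholesky (D : ℕ) : Continuous (cholesky : SPD D → Matrix (Fin D) (Fin D) ℝ) := by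
  suffices h : ∀ i j, Continuous fun Q : SPD D => cholesky Q i j from continuous_matrix h
  intro i
  induction i using WellFoundedLT.induction with
  | ind i ih =>
    have hentry : ∀ (Q : SPD D) (j : Fin D), cholesky Q i i * cholesky Q i j =
        Q.1 i j - ∑ k ∈ Finset.univ.filter (· < i), cholesky Q k i * cholesky Q k j := by
      intro Q j
      rw [SPD.entry_eq_sum_cholesky, eq_sub_iff_add_eq, add_comm,
        ← Finset.sum_filter_add_sum_filter_not Finset.univ (· < i)]
      congr 1
      rw [Finset.sum_eq_single_of_mem i (by simp)]
      intro k hk hki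
      have : i < k := lt_of_le_of_ne (by simpa using hk) (Ne.symm hki)
      rw [(cholesky_spec Q).1 k i this, zero_mul]
    have hrhs : ∀ j, Continuous fun Q : SPD D =>
        Q.1 i j - ∑ k ∈ Finset.univ.filter (· < i), cholesky Q k i * cholesky Q k j := by
      intro j
      refine (SPD.continuous_entry i j).sub (continuous_finsetSum _ fun k hk => ?_)
      have hk' : k < i := by simpa using hk
      exact (ih k hk' i).mul (ih k hk' j)
    have hdiag : Continuous fun Q : SPD D => cholesky Q i i := by
      refine (hrhs i).sqrt.congr fun Q => ?_
      rw [← hentry, Real.sqrt_mul_self ((cholesky_spec Q).2.1 i).le]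
    intro j
    refine ((hrhs j).div hdiag fun Q => ((cholesky_spec Q).2.1 i).ne').congr fun Q => ?_
    rw [Pi.div_apply, ← hentry, mul_div_cancel_left₀ _ ((cholesky_spec Q).2.1 i).ne']

theorem SPD.diag_nonneg {D : ℕ} (Q : SPD D) (i : Fin D) : 0 ≤ Q.1 i i := by
  rw [SPD.entry_eq_sum_cholesky]
  exact Finset.sum_nonneg fun k _ => mul_self_nonneg _

theorem SPD.abs_entry_le {D : ℕ} (Q : SPD D) (i j : Fin D) :
    |Q.1 i j| ≤ (Q.1 i i + Q.1 j j) / 2 := by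
  simp only [SPD.entry_eq_sum_cholesky, ← Finset.sum_add_distrib, Finset.sum_div]
  refine (Finset.abs_sum_le_sum_abs _ _).trans (Finset.sum_le_sum fun k _ => ?_)
  rw [abs_mul]
  nlinarith [sq_nonneg (|cholesky Q k i| - |cholesky Q k j|), sq_abs (cholesky Q k i),
    sq_abs (cholesky Q k j)]

theorem SPD.sum_abs_upperEntries_le {D : ℕ} (Q : SPD D) :
    ∑ p, |upperEntries D Q p| ≤ D * Q.1.trace := by
  calc ∑ p, |upperEntries D Q p|
      = ∑ p ∈ Finset.univ.filter (fun p : Fin D × Fin D => p.1 ≤ p.2), |Q.1 p.1 p.2| :=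
        (Finset.sum_subtype (p := fun p : Fin D × Fin D => p.1 ≤ p.2) _ (by simp)
          fun p : Fin D × Fin D => |Q.1 p.1 p.2|).symm
    _ ≤ ∑ p : Fin D × Fin D, |Q.1 p.1 p.2| :=
        Finset.sum_le_sum_of_subset_of_nonneg (Finset.filter_subset _ _)
          fun _ _ _ => abs_nonneg _
    _ ≤ ∑ p : Fin D × Fin D, (Q.1 p.1 p.1 + Q.1 p.2 p.2) / 2 :=
        Finset.sum_le_sum fun p _ => Q.abs_entry_le p.1 p.2
    _ = D * Q.1.trace := by
        rw [Fintype.sum_prod_type]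
        simp only [← Finset.sum_div, Finset.sum_add_distrib, Finset.sum_const, Finset.card_univ,
          Fintype.card_fin, nsmul_eq_mul, ← Finset.mul_sum, Matrix.trace, Matrix.diag_apply]
        ring

theorem SPD.log_det_le_trace {D : ℕ} (Q : SPD D) : Real.log Q.1.det ≤ Q.1.trace := by
  rw [Q.2.isHermitian.det_eq_prod_eigenvalues, Q.2.isHermitian.trace_eq_sum_eigenvalues]
  have h := Q.2.eigenvalues_pos
  simp only [RCLike.ofReal_real_eq_id, id_eq]
  rw [Real.log_prod fun i _ => (h i).ne']
  refine Finset.sum_le_sum fun i _ => ?_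
  linarith [Real.log_le_sub_one_of_pos (h i)]

/-! ### Integrability of the trace weight -/

theorem integrable_exp_neg_abs_div_two : Integrable fun x : ℝ => Real.exp (-(|x| / 2)) := by
  refine (integrable_inv_one_add_sq.const_mul 8).mono' (by fun_prop) (ae_of_all _ fun x => ?_)
  rw [Real.norm_of_nonneg (Real.exp_pos _).le, Real.exp_neg]
  have h := Real.quadratic_le_exp_of_nonneg (x := |x| / 2) (by positivity)
  have h2 : (1 + x ^ 2) / 8 ≤ Real.exp (|x| / 2) := by
    nlinarith [sq_abs x, abs_nonneg x]
  rw [show 8 * (1 + x ^ 2)⁻¹ = ((1 + x ^ 2) / 8)⁻¹ by rw [inv_div, div_eq_mul_inv]]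
  exact inv_anti₀ (by positivity) h2

/-- The entries of a positive definite matrix are dominated by its trace, so the weight is bounded
by a product of one-dimensional integrable functions of the coordinates. -/
theorem integrable_exp_neg_trace (D : ℕ) :
    Integrable (fun Q : SPD D => Real.exp (-(((D : ℝ) + 1) / 2 * Q.1.trace))) (lebesgueSPD D) := by
  have h1 : Integrable (fun v : {p : Fin D × Fin D // p.1 ≤ p.2} → ℝ =>
      ∏ p, Real.exp (-(|v p| / 2))) (volume.restrict (Set.range (upperEntries D))) :=
    (Integrable.fintype_prod fun _ => integrable_exp_neg_abs_div_two).restrict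
  rw [← (measurableEmbedding_upperEntries D).map_comap,
    (measurableEmbedding_upperEntries D).integrable_map_iff] at h1
  refine h1.mono' ?_ (ae_of_all _ fun Q => ?_)
  · refine Continuous.aestronglyMeasurable ?_
    have := (continuous_subtype_val : Continuous fun Q : SPD D => Q.1).matrix_trace
    fun_prop
  · rw [Real.norm_of_nonneg (Real.exp_pos _).le, Function.comp_apply, ← Real.exp_sum]
    refine Real.exp_le_exp.mpr ?_
    rw [Finset.sum_neg_distrib, ← Finset.sum_div]
    have htr : 0 ≤ Q.1.trace := Finset.sum_nonneg fun i _ => Q.diag_nonneg i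
    have := Q.sum_abs_upperEntries_le
    linarith

end DLN

/-! ### Positivity and continuity of the likelihood terms -/

namespace DLN

theorem one_le_det_one_add {n : Type*} [Fintype n] [DecidableEq n] {M : Matrix n n ℝ}
    (hM : M.PosSemidef) : 1 ≤ (1 + M).det := by
  have hH : (1 + M).IsHermitian := Matrix.isHermitian_one.add hM.isHermitian
  rw [hH.det_eq_prod_eigenvalues]
  refine Finset.one_le_prod fun i _ => ?_
  have h0 : ∑ j, hH.eigenvectorBasis i j * hH.eigenvectorBasis i j = 1 := by
    have := hH.eigenvectorBasis.norm_eq_one i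
    rw [EuclideanSpace.norm_eq, Real.sqrt_eq_one] at this
    simpa [sq] using this
  have h1 := hM.dotProduct_mulVec_nonneg (hH.eigenvectorBasis i).ofLp
  have h2 := hH.eigenvalues_eq i
  rw [Matrix.add_mulVec, dotProduct_add, Matrix.one_mulVec] at h2
  simp only [star_trivial, RCLike.re_to_real] at h1 h2
  rw [show (hH.eigenvectorBasis i).ofLp ⬝ᵥ (hH.eigenvectorBasis i).ofLp = 1 from h0] at h2
  simp only [RCLike.ofReal_real_eq_id, id_eq]
  linarith

section Model

variable {L D P N₀ : ℕ} {lam : Fin (L + 1) → ℝ} {X : Matrix (Fin N₀) (Fin P) ℝ}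
  {y : Fin P × Fin D → ℝ} {β : ℝ}

theorem posSemidef_sigma11 (hlam : ∀ ℓ, 0 < lam ℓ) (Q : Fin L → SPD D) :
    (sigma11 lam X Q).PosSemidef := by
  have hpos : 0 ≤ ((N₀ : ℝ) * ∏ ℓ, lam ℓ)⁻¹ :=
    inv_nonneg.mpr (mul_nonneg (Nat.cast_nonneg _) (Finset.prod_nonneg fun ℓ _ => (hlam ℓ).le))
  have hgram : ∀ {m n : ℕ} (A : Matrix (Fin m) (Fin n) ℝ), (Aᵀ * A).PosSemidef := fun A => by
    simpa using Matrix.posSemidef_conjTranspose_mul_self A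
  exact ((hgram X).smul hpos).kronecker (hgram _)

theorem posDef_sigma11_add (hlam : ∀ ℓ, 0 < lam ℓ) (hβ : 0 < β) (Q : Fin L → SPD D) :
    (sigma11 lam X Q + β⁻¹ • (1 : Matrix (Fin P × Fin D) (Fin P × Fin D) ℝ)).PosDef := by
  rw [add_comm]
  exact (Matrix.PosDef.one.smul (inv_pos.mpr hβ)).add_posSemidef (posSemidef_sigma11 hlam Q)

theorem phiMF_nonneg (hlam : ∀ ℓ, 0 < lam ℓ) (hβ : 0 < β) (Q : Fin L → SPD D) :
    0 ≤ phiMF lam X y β Q := by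
  simpa [phiMF] using (posDef_sigma11_add hlam hβ Q).inv.posSemidef.dotProduct_mulVec_nonneg y

theorem one_le_det_one_add_sigma11 (hlam : ∀ ℓ, 0 < lam ℓ) (hβ : 0 < β) (Q : Fin L → SPD D) :
    1 ≤ (1 + β • sigma11 lam X Q).det :=
  one_le_det_one_add ((posSemidef_sigma11 hlam Q).smul hβ.le)

theorem logDetTerm_nonneg (hlam : ∀ ℓ, 0 < lam ℓ) (hβ : 0 < β) (Q : Fin L → SPD D) :
    0 ≤ logDetTerm lam X β Q :=
  Real.log_nonneg (one_le_det_one_add_sigma11 hlam hβ Q)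

theorem continuous_sigma11 (lam : Fin (L + 1) → ℝ) (X : Matrix (Fin N₀) (Fin P) ℝ) :
    Continuous fun Q : Fin L → SPD D => sigma11 lam X Q := by
  have hprod : Continuous fun Q : Fin L → SPD D => (List.ofFn fun ℓ => cholesky (Q ℓ)).prod := by
    simp only [List.ofFn_eq_map]
    exact continuous_list_prod _ fun ℓ _ => (continuous_cholesky D).comp (continuous_apply ℓ)
  have hout : Continuous fun Q : Fin L → SPD D => outputCov Q :=
    hprod.matrix_transpose.matrix_mul hprod
  exact continuous_matrix fun i j => continuous_const.mul (hout.matrix_elem i.2 j.2)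

theorem continuous_phiMF (hlam : ∀ ℓ, 0 < lam ℓ) (hβ : 0 < β) :
    Continuous fun Q : Fin L → SPD D => phiMF lam X y β Q := by
  have h : Continuous fun Q : Fin L → SPD D =>
      sigma11 lam X Q + β⁻¹ • (1 : Matrix (Fin P × Fin D) (Fin P × Fin D) ℝ) :=
    (continuous_sigma11 lam X).add continuous_const
  have hinv : Continuous fun Q : Fin L → SPD D =>
      (sigma11 lam X Q + β⁻¹ • (1 : Matrix (Fin P × Fin D) (Fin P × Fin D) ℝ))⁻¹ := by
    simp only [Matrix.inv_def, Ring.inverse_eq_inv']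
    exact (h.matrix_det.inv₀ fun Q => (posDef_sigma11_add hlam hβ Q).det_pos.ne').smul
      h.matrix_adjugate
  exact continuous_const.dotProduct (hinv.matrix_mulVec continuous_const)

theorem continuous_logDetTerm (hlam : ∀ ℓ, 0 < lam ℓ) (hβ : 0 < β) :
    Continuous fun Q : Fin L → SPD D => logDetTerm lam X β Q := by
  refine Continuous.log ?_ fun Q =>
    (zero_lt_one.trans_le (one_le_det_one_add_sigma11 hlam hβ Q)).ne'
  exact (continuous_const.add ((continuous_sigma11 lam X).const_smul β)).matrix_det

theorem SPD.continuous_trace (D : ℕ) : Continuous fun Q : SPD D => Q.1.trace :=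
  (continuous_subtype_val : Continuous fun Q : SPD D => Q.1).matrix_trace

theorem SPD.continuous_det (D : ℕ) : Continuous fun Q : SPD D => Q.1.det :=
  (continuous_subtype_val : Continuous fun Q : SPD D => Q.1).matrix_det

theorem continuous_actionMF (hlam : ∀ ℓ, 0 < lam ℓ) (hβ : 0 < β) :
    Continuous fun Q : Fin L → SPD D => actionMF lam X y β Q := by
  refine (continuous_finsetSum _ fun ℓ _ => ?_).add (continuous_phiMF hlam hβ)
  have h : Continuous fun Q : SPD D => Q.1.trace - Real.log Q.1.det :=
    (SPD.continuous_trace D).sub ((SPD.continuous_det D).log fun Q => Q.2.det_pos.ne')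
  exact h.comp (continuous_apply ℓ)

theorem actionMF_nonneg (hlam : ∀ ℓ, 0 < lam ℓ) (hβ : 0 < β) (Q : Fin L → SPD D) :
    0 ≤ actionMF lam X y β Q :=
  add_nonneg (Finset.sum_nonneg fun ℓ _ => sub_nonneg.mpr (Q ℓ).log_det_le_trace)
    (phiMF_nonneg hlam hβ Q)

/-! ### The posterior as a Gibbs measure -/

/-- The `N`-independent part of the posterior density: `∏_ℓ det(Q_ℓ)^(-(D+1)/2) exp(-R/2)`. -/
noncomputable def referenceDensity (lam : Fin (L + 1) → ℝ) (X : Matrix (Fin N₀) (Fin P) ℝ) (β : ℝ)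
    (Q : Fin L → SPD D) : ℝ :=
  (∏ ℓ, (Q ℓ).1.det ^ (-((D : ℝ) + 1) / 2)) * Real.exp (-(1 / 2) * logDetTerm lam X β Q)

/-- The measure of density `referenceDensity` with respect to `dQ_1 ⋯ dQ_L`. It need not be
finite. -/
noncomputable def referenceMeasure (D : ℕ) (lam : Fin (L + 1) → ℝ) (X : Matrix (Fin N₀) (Fin P) ℝ)
    (β : ℝ) : Measure (Fin L → SPD D) :=
  (Measure.pi fun _ : Fin L => lebesgueSPD D).withDensity fun Q =>
    ENNReal.ofReal (referenceDensity lam X β Q)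

theorem referenceDensity_pos (Q : Fin L → SPD D) : 0 < referenceDensity lam X β Q :=
  mul_pos (Finset.prod_pos fun ℓ _ => Real.rpow_pos_of_pos (Q ℓ).2.det_pos _) (Real.exp_pos _)

theorem continuous_referenceDensity (hlam : ∀ ℓ, 0 < lam ℓ) (hβ : 0 < β) :
    Continuous fun Q : Fin L → SPD D => referenceDensity lam X β Q := by
  refine (continuous_finsetProd _ fun ℓ _ => ?_).mul
    (Real.continuous_exp.comp (continuous_const.mul (continuous_logDetTerm hlam hβ)))
  exact ((SPD.continuous_det D).comp (continuous_apply ℓ)).rpow_const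
    fun Q => Or.inl (Q ℓ).2.det_pos.ne'

theorem isOpenPosMeasure_referenceMeasure (hlam : ∀ ℓ, 0 < lam ℓ) (hβ : 0 < β) :
    (referenceMeasure D lam X β).IsOpenPosMeasure := by
  refine (withDensity_absolutelyContinuous' ?_ ?_).isOpenPosMeasure
  · exact (continuous_referenceDensity hlam hβ).measurable.ennreal_ofReal.aemeasurable
  · exact ae_of_all _ fun Q => (ENNReal.ofReal_pos.mpr (referenceDensity_pos Q)).ne'

theorem continuous_wishartDensity (D N : ℕ) (V : Matrix (Fin D) (Fin D) ℝ) :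
    Continuous fun Q : SPD D => wishartDensity D V N Q.1 := by
  refine Continuous.div_const (Continuous.mul ?_ ?_) _
  · exact (SPD.continuous_det D).rpow_const fun Q => Or.inl Q.2.det_pos.ne'
  · exact Real.continuous_exp.comp (continuous_const.mul
      (continuous_const.matrix_mul continuous_subtype_val).matrix_trace)

/-- The explicit value of the normalizing constant `c` plays no role, since it cancels in the
posterior. -/
theorem exists_wishartDensity_eq {D N : ℕ} (hN : D < N) : ∃ c : ℝ, 0 < c ∧ ∀ Q : SPD D,
    wishartDensity D ((N : ℝ)⁻¹ • (1 : Matrix (Fin D) (Fin D) ℝ)) N Q.1 =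
      c * (Q.1.det ^ (-((D : ℝ) + 1) / 2) *
        Real.exp (-(N * ((Q.1.trace - Real.log Q.1.det) / 2)))) := by
  have hN0 : (0 : ℝ) < N := by
    exact_mod_cast (Nat.zero_le D).trans_lt hN
  have hND : (D : ℝ) < N := by
    exact_mod_cast hN
  have hV : 0 < ((N : ℝ)⁻¹ • (1 : Matrix (Fin D) (Fin D) ℝ)).det :=
    (Matrix.PosDef.one.smul (inv_pos.mpr hN0)).det_pos
  have hΓ : 0 < ∏ k : Fin D, Real.Gamma (((N : ℝ) - D + ((k : ℕ) + 1)) / 2) :=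
    Finset.prod_pos fun k _ => Real.Gamma_pos_of_pos
      (div_pos (add_pos (sub_pos.mpr hND) (by positivity)) two_pos)
  refine ⟨_, inv_pos.mpr (mul_pos (mul_pos (mul_pos (Real.rpow_pos_of_pos hV ((N : ℝ) / 2))
    (Real.rpow_pos_of_pos two_pos ((D : ℝ) * N / 2)))
    (Real.rpow_pos_of_pos Real.pi_pos ((D : ℝ) * ((D : ℝ) - 1) / 4))) hΓ), fun Q => ?_⟩
  rw [wishartDensity, div_eq_inv_mul]
  congr 1
  have hinv : ((N : ℝ)⁻¹ • (1 : Matrix (Fin D) (Fin D) ℝ))⁻¹ = (N : ℝ) • 1 :=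
    Matrix.inv_eq_left_inv (by simp [hN0.ne'])
  rw [hinv, Matrix.smul_mul, Matrix.one_mul, Matrix.trace_smul, smul_eq_mul,
    Real.rpow_def_of_pos Q.2.det_pos, Real.rpow_def_of_pos Q.2.det_pos, ← Real.exp_add,
    ← Real.exp_add]
  congr 1
  ring

theorem exists_prior_mul_weight_eq {N : ℕ} (hN : D < N) : ∃ c : ℝ, 0 < c ∧ ∀ Q : Fin L → SPD D,
    ENNReal.ofReal (∏ ℓ, wishartDensity D ((N : ℝ)⁻¹ • (1 : Matrix (Fin D) (Fin D) ℝ)) N (Q ℓ).1) *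
        weightMF lam X y β N Q =
      ENNReal.ofReal c * (ENNReal.ofReal (referenceDensity lam X β Q) *
        gibbsWeight (fun Q => actionMF lam X y β Q / 2) N Q) := by
  obtain ⟨c, hc, hcQ⟩ := exists_wishartDensity_eq hN
  refine ⟨c ^ L, by positivity, fun Q => ?_⟩
  have hdet : 0 ≤ ∏ ℓ, (Q ℓ).1.det ^ (-((D : ℝ) + 1) / 2) :=
    Finset.prod_nonneg fun ℓ _ => Real.rpow_nonneg (Q ℓ).2.det_pos.le _
  simp only [hcQ, Finset.prod_mul_distrib, Finset.prod_const, Finset.card_univ, Fintype.card_fin,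
    ← Real.exp_sum]
  rw [weightMF, gibbsWeight, referenceDensity, ← ENNReal.ofReal_mul (by positivity),
    ← ENNReal.ofReal_mul (by positivity), ← ENNReal.ofReal_mul (by positivity)]
  congr 1
  rw [mul_assoc, mul_assoc, mul_assoc, ← Real.exp_add, ← Real.exp_add]
  congr 3
  rw [actionMF, Finset.sum_neg_distrib, ← Finset.mul_sum, ← Finset.sum_div]
  ring

theorem posteriorMF_eq_gibbs (hlam : ∀ ℓ, 0 < lam ℓ) (hβ : 0 < β) {N : ℕ} (hN : D < N) :
    posteriorMF (L := L) lam X y β N =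
      (∫⁻ Q, gibbsWeight (fun Q => actionMF lam X y β Q / 2) N Q ∂referenceMeasure D lam X β)⁻¹ •
        (referenceMeasure D lam X β).withDensity
          (gibbsWeight (fun Q => actionMF lam X y β Q / 2) N) := by
  obtain ⟨c, hc, hcQ⟩ := exists_prior_mul_weight_eq (lam := lam) (X := X) (y := y) (β := β) hN
  have hmeasG : Measurable
      (gibbsWeight (fun Q : Fin L → SPD D => actionMF lam X y β Q / 2) N) :=
    (Real.continuous_exp.comp (continuous_const.mul
      ((continuous_actionMF hlam hβ).div_const 2)).neg).measurable.ennreal_ofReal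
  have hmeasR : Measurable fun Q : Fin L → SPD D =>
      ENNReal.ofReal (referenceDensity lam X β Q) :=
    (continuous_referenceDensity hlam hβ).measurable.ennreal_ofReal
  have hmeasW : Measurable fun Q : Fin L → SPD D => weightMF lam X y β N Q :=
    (Real.continuous_exp.comp ((continuous_const.mul (continuous_phiMF hlam hβ)).sub
      (continuous_const.mul (continuous_logDetTerm hlam hβ)))).measurable.ennreal_ofReal
  have hmeasP : Measurable fun Q : Fin L → SPD D => ENNReal.ofReal
      (∏ ℓ, wishartDensity D ((N : ℝ)⁻¹ • (1 : Matrix (Fin D) (Fin D) ℝ)) N (Q ℓ).1) :=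
    (continuous_finsetProd _ fun ℓ _ =>
      (continuous_wishartDensity D N _).comp (continuous_apply ℓ)).measurable.ennreal_ofReal
  have hdens : (priorMixing L D fun _ => N).withDensity (weightMF lam X y β N) =
      ENNReal.ofReal c • (referenceMeasure D lam X β).withDensity
        (gibbsWeight (fun Q => actionMF lam X y β Q / 2) N) := by
    rw [priorMixing, referenceMeasure, ← withDensity_mul _ hmeasP hmeasW,
      ← withDensity_mul _ hmeasR hmeasG, ← withDensity_smul _ (hmeasR.mul hmeasG)]
    congr 1
    exact funext hcQ
  have hc0 : ENNReal.ofReal c ≠ 0 := (ENNReal.ofReal_pos.mpr hc).ne'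
  have hZ : ∫⁻ Q, weightMF lam X y β N Q ∂(priorMixing L D fun _ => N) = ENNReal.ofReal c *
      ∫⁻ Q, gibbsWeight (fun Q => actionMF lam X y β Q / 2) N Q ∂referenceMeasure D lam X β := by
    have := congrArg (fun μ => μ Set.univ) hdens
    simpa [withDensity_apply _ MeasurableSet.univ] using this
  rw [posteriorMF, hdens, hZ, smul_smul, ENNReal.mul_inv (Or.inl hc0) (Or.inl ENNReal.ofReal_ne_top),
    mul_right_comm, ENNReal.inv_mul_cancel hc0 ENNReal.ofReal_ne_top, one_mul]

/-- At `N = D + 1` the determinants of the Wishart density and of the reference density cancel. -/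
theorem referenceDensity_mul_gibbs_le (hlam : ∀ ℓ, 0 < lam ℓ) (hβ : 0 < β) (Q : Fin L → SPD D) :
    referenceDensity lam X β Q *
        Real.exp (-(((D + 1 : ℕ) : ℝ) * (actionMF lam X y β Q / 2))) ≤
      ∏ ℓ, Real.exp (-(((D : ℝ) + 1) / 2 * (Q ℓ).1.trace)) := by
  simp only [referenceDensity, Real.rpow_def_of_pos (Q _).2.det_pos]
  rw [← Real.exp_sum, ← Real.exp_sum, ← Real.exp_add, ← Real.exp_add]
  refine Real.exp_le_exp.mpr ?_
  rw [← Finset.sum_mul, Finset.sum_neg_distrib, ← Finset.mul_sum, actionMF,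
    Finset.sum_sub_distrib]
  push_cast
  have h1 := phiMF_nonneg (X := X) (y := y) hlam hβ Q
  have h2 := logDetTerm_nonneg (X := X) hlam hβ Q
  have h3 : 0 ≤ ((D : ℝ) + 1) * phiMF lam X y β Q := by positivity
  linarith

theorem lintegral_gibbsWeight_ne_top (hlam : ∀ ℓ, 0 < lam ℓ) (hβ : 0 < β) {N : ℕ} (hN : D < N) :
    ∫⁻ Q, gibbsWeight (fun Q : Fin L → SPD D => actionMF lam X y β Q / 2) N Q
      ∂referenceMeasure D lam X β ≠ ∞ := by
  have hbase : ∫⁻ Q, gibbsWeight (fun Q : Fin L → SPD D => actionMF lam X y β Q / 2) (D + 1) Q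
      ∂referenceMeasure D lam X β < ∞ := by
    rw [referenceMeasure, lintegral_withDensity_eq_lintegral_mul₀]
    · refine lt_of_le_of_lt (lintegral_mono fun Q => ?_)
        (Integrable.fintype_prod (ι := Fin L) fun _ => integrable_exp_neg_trace D).lintegral_lt_top
      rw [Pi.mul_apply, gibbsWeight, ← ENNReal.ofReal_mul (referenceDensity_pos Q).le]
      exact ENNReal.ofReal_le_ofReal (referenceDensity_mul_gibbs_le hlam hβ Q)
    · exact (continuous_referenceDensity hlam hβ).measurable.ennreal_ofReal.aemeasurable
    · exact (Real.continuous_exp.comp (continuous_const.mul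
        ((continuous_actionMF hlam hβ).div_const 2)).neg).measurable.ennreal_ofReal.aemeasurable
  have h := setLIntegral_gibbsWeight_le (ν := referenceMeasure D lam X β) MeasurableSet.univ
    (fun Q _ => div_nonneg (actionMF_nonneg (X := X) (y := y) hlam hβ Q) zero_le_two)
    (Nat.succ_le_of_lt hN)
  rw [setLIntegral_univ] at h
  exact (h.trans_lt (ENNReal.mul_lt_top ENNReal.ofReal_lt_top hbase)).ne

end Model

end DLN

theorem proposition6 {L D P N₀ : ℕ} (lam : Fin (L + 1) → ℝ) (hlam : ∀ ℓ, 0 < lam ℓ)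
    (X : Matrix (Fin N₀) (Fin P) ℝ) (y : Fin P × Fin D → ℝ) (β : ℝ) (hβ : 0 < β) :
    (∀ N : ℕ, D < N →
      IsProbabilityMeasure (DLN.posteriorMF (L := L) lam X y β N)) ∧
    BddBelow (Set.range (DLN.actionMF (L := L) lam X y β)) ∧
    DLN.SatisfiesLDP (fun N : ℕ => DLN.posteriorMF (L := L) lam X y β N)
      (fun Q => (DLN.rateMF (L := L) lam X y β Q : EReal)) := by
  have hcont : Continuous fun Q : Fin L → DLN.SPD D => DLN.actionMF lam X y β Q / 2 :=
    (DLN.continuous_actionMF hlam hβ).div_const 2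
  have hpos := DLN.isOpenPosMeasure_referenceMeasure (D := D) (X := X) hlam hβ
  refine ⟨fun N hN => ?_, ⟨0, ?_⟩, ?_⟩
  · rw [DLN.posteriorMF_eq_gibbs hlam hβ hN]
    exact DLN.isProbabilityMeasure_gibbs hcont (DLN.lintegral_gibbsWeight_ne_top hlam hβ hN)
  · rintro _ ⟨Q, rfl⟩
    exact DLN.actionMF_nonneg hlam hβ Q
  · have hbdd : BddBelow (Set.range fun Q : Fin L → DLN.SPD D => DLN.actionMF lam X y β Q / 2) := by
      refine ⟨0, ?_⟩
      rintro _ ⟨Q, rfl⟩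
      exact div_nonneg (DLN.actionMF_nonneg hlam hβ Q) zero_le_two
    have hldp := DLN.satisfiesLDP_gibbs hcont hbdd
      (DLN.lintegral_gibbsWeight_ne_top hlam hβ (Nat.lt_succ_self D))
      (P := fun N => DLN.posteriorMF lam X y β N)
      fun N hN => DLN.posteriorMF_eq_gibbs hlam hβ (Nat.lt_of_succ_le hN)
    convert hldp using 3 with Q
    have hinf : ⨅ Q : Fin L → DLN.SPD D, DLN.actionMF lam X y β Q / 2 =
        (1 / 2) * ⨅ Q : Fin L → DLN.SPD D, DLN.actionMF lam X y β Q := by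
      rw [Real.mul_iInf_of_nonneg (by norm_num)]
      exact iInf_congr fun Q => by ring
    rw [hinf, DLN.rateMF, DLN.actionMF]
    ring
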